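/- Let $\gamma=\frac{1+\sqrt5}{2}$ be the golden ratio, $p=\gamma^3$, $q=\gamma^2$, $\alpha=1/p=\gamma^{-3}$, $\beta=1/q=\gamma^{-2}$. For $0<a<\tfrac12$ let $C_a=\bigcap_{n\ge 0}\psi_a^{-n}\big([0,a]\cup[1-a,1]\big)$ be the middle-$(1-2a)$ Cantor set, where $\psi_a(x)=x/a$ on $[0,a]$ and $\psi_a(x)=(x-1)/a+1$ on $[1-a,1]$, and let $$C_\alpha-\tfrac{2}{\gamma}C_\beta=\{x-\tfrac{2}{\gamma}y : x\in C_\alpha,\ y\in C_\beta\}.$$ Let $$A=\begin{pmatrix}5&11&3&11&5\\2&6&2&6&2\\4&10&3&10&4\\0&2&0&1&2\\0&8&2&6&5\end{pmatrix}$$ and let $L$ be the largest real eigenvalue of $A$. Then $$\dim_H\big(C_\alpha-\tfrac{2}{\gamma}C_\beta\big)=\log_{p^2}L ,$$ and the box dimension of $C_\alpha-\frac{2}{\gamma}C_\beta$ exists and equals the same number. Numerically, $17.186<L<17.187$ and $0.9850<\log_{p^2}L<0.9851$. -/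

import Mathlib

open Filter Topology

noncomputable section

/-- The expanding map of the middle-`(1 - 2α)` Cantor set: `x ↦ p x` on `[0, α]` and
`x ↦ p x - p + 1` on `[1 - α, 1]`, where `p = 1 / α`. Its values off these two intervals play
no role in the definition of `middleCantor`. -/
def middleCantorMap (α x : ℝ) : ℝ :=
  if x ≤ α then α⁻¹ * x else α⁻¹ * x - α⁻¹ + 1

/-- The middle Cantor set `C_α = ⋂ₙ ψ⁻ⁿ([0, α] ∪ [1 - α, 1])` (for `0 < α < 1/2`), where `ψ` is
the expanding map above. -/
def middleCantor (α : ℝ) : Set ℝ :=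
  {x | ∀ n : ℕ, (middleCantorMap α)^[n] x ∈ Set.Icc 0 α ∪ Set.Icc (1 - α) 1}

/-- The arithmetic difference `C_α - s C_β = {x - s y : x ∈ C_α, y ∈ C_β}`. -/
def cantorDifference (α β s : ℝ) : Set ℝ :=
  {t | ∃ x ∈ middleCantor α, ∃ y ∈ middleCantor β, t = x - s * y}

/-- `S` is a nonempty bounded set of real numbers whose box (Minkowski) dimension exists and
equals `d`: with `N(S, ε)` the least number of closed intervals of radius `ε` covering `S`,
`log N(S, ε) / log (1 / ε) → d` as `ε → 0⁺`. -/
def HasBoxDimension (S : Set ℝ) (d : ℝ) : Prop :=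
  S.Nonempty ∧ Bornology.IsBounded S ∧
    Tendsto (fun ε : NNReal =>
        Real.log ((Metric.externalCoveringNumber ε S).toNat : ℝ) / Real.log (1 / (ε : ℝ)))
      (𝓝[>] (0 : NNReal)) (𝓝 d)

/-- The explicit `5 × 5` matrix. -/
def matrixA : Matrix (Fin 5) (Fin 5) ℝ :=
  !![5, 11, 3, 11, 5;
     2,  6, 2,  6, 2;
     4, 10, 3, 10, 4;
     0,  2, 0,  1, 2;
     0,  8, 2,  6, 5]

end

/-!
Write `γ` for the golden ratio. Two steps of the coding of `C_α` and three steps of the coding of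
`C_β` contract by the same factor `γ⁻⁶`, so `T = C_α - (2 / γ) C_β` is the attractor of the maps
`s ↦ γ⁻⁶ (s + 2 d)`, where `d` runs through a set of `21` digits in `ℤ[γ]`
(`mem_goldenDifference_iff`). Let `X_n ⊆ ℤ[γ]` be the set of sums `∑_{k < n} γ ^ (6 k) d_k`.

Since `γ` is a Pisot number, the conjugates of the elements of all `X_n` are uniformly bounded. Hence
two elements of `X_n` at distance at most `1.12` differ by `0`, `±1` or `±γ⁻¹`
(`sub_mem_smallDiffs`); in particular `X_n` is separated. In passing from `X_n` to
`X_{n+1} = γ ^ 6 X_n + D` coincidences come only from pairs of elements at distance `1` or `γ⁻¹`, so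
the number of elements and the numbers of pairs of the two kinds satisfy a linear recursion
(`card_image_mulUnit_add`). Its characteristic polynomial `x³ - 19 x² + 31 x + 3` is a factor of that
of the given matrix, the other factors being `x` and `x - 1`, and the left eigenvector for the
largest root `L` gives `L ^ n ≤ #X_n ≤ 3 L ^ n`.

The points `2 γ ^ (-6 n) x`, `x ∈ X_n`, thus form a regular net of `T` (`isRegularNet_goldenNet`). For
any closed set with such nets the covering numbers are comparable to `ε ^ (-d)` with
`d = log L / log γ ^ 6`, which gives the box dimension and the upper bound for the Hausdorff
dimension. For the lower bound, a limit along an ultrafilter of the normalized counting functions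
of the nets is Hölder continuous of exponent `d` and maps `T` onto a set containing an interval.
-/

open scoped ENNReal NNReal Pointwise

/-! ### Regular nets and dimension -/

/-- `P` is a sequence of finite `c r ^ n`-separated `R r ^ n`-nets of the set `T`, which lies in the
ball of radius `R` about `0`; the `n`-th net has at least `L ^ n` points and the `(k + m)`-th net
has at most `K L ^ m` points in any ball of radius `R r ^ k`. -/
structure IsRegularNet (T : Set ℝ) (r L R c K : ℝ) (P : ℕ → Finset ℝ) : Prop where
  r_pos : 0 < r
  r_lt_one : r < 1
  one_lt_L : 1 < L
  R_pos : 0 < R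
  c_pos : 0 < c
  K_pos : 0 < K
  abs_le : ∀ t ∈ T, |t| ≤ R
  subset : ∀ n, ∀ x ∈ P n, x ∈ T
  cover : ∀ n, ∀ t ∈ T, ∃ x ∈ P n, |t - x| ≤ R * r ^ n
  sep : ∀ n, ∀ x ∈ P n, ∀ y ∈ P n, x ≠ y → c * r ^ n ≤ |x - y|
  le_card : ∀ n, L ^ n ≤ ((P n).card : ℝ)
  local_card : ∀ k m t, (((P (k + m)).filter fun x => |x - t| ≤ R * r ^ k).card : ℝ) ≤ K * L ^ m

namespace IsRegularNet

variable {T : Set ℝ} {r L R c K : ℝ} {P : ℕ → Finset ℝ}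

lemma card_le (h : IsRegularNet T r L R c K P) (n : ℕ) : ((P n).card : ℝ) ≤ K * L ^ n := by
  have := h.local_card 0 n 0
  rwa [zero_add, Finset.filter_true_of_mem] at this
  intro x hx
  simpa using h.abs_le x (h.subset n x hx)

lemma dim_pos (h : IsRegularNet T r L R c K P) : 0 < Real.logb r⁻¹ L :=
  Real.logb_pos ((one_lt_inv₀ h.r_pos).2 h.r_lt_one) h.one_lt_L

/-- The exponent `log L / log (1 / r)` is the solution `d` of `r ^ d = L⁻¹`. -/
lemma pow_rpow_dim (h : IsRegularNet T r L R c K P) (n : ℕ) :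
    (r ^ n) ^ (Real.logb r⁻¹ L) = (L ^ n)⁻¹ := by
  have hr := h.r_pos
  have h1 : r ^ Real.logb r⁻¹ L = L⁻¹ := by
    have h2 : r⁻¹ ^ Real.logb r⁻¹ L = L :=
      Real.rpow_logb (inv_pos.2 hr) ((one_lt_inv₀ hr).2 h.r_lt_one).ne'
        (zero_lt_one.trans h.one_lt_L)
    rw [Real.inv_rpow hr.le] at h2
    rw [← inv_inv (r ^ _), h2]
  rw [← Real.rpow_natCast, ← Real.rpow_mul hr.le, mul_comm, Real.rpow_mul hr.le, h1,
    Real.rpow_natCast, inv_pow]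

lemma nonempty (h : IsRegularNet T r L R c K P) : T.Nonempty := by
  have h0 := h.le_card 0
  have : (P 0).Nonempty := by
    rw [← Finset.card_pos]
    have : (0 : ℝ) < (P 0).card := lt_of_lt_of_le (by norm_num) h0
    exact_mod_cast this
  obtain ⟨x, hx⟩ := this
  exact ⟨x, h.subset 0 x hx⟩

lemma externalCoveringNumber_le (h : IsRegularNet T r L R c K P) {ε : ℝ≥0} {n : ℕ}
    (hε : R * r ^ n ≤ ε) : Metric.externalCoveringNumber ε T ≤ ((P n).card : ℕ∞) := by
  have hc : Metric.IsCover ε T (P n : Set ℝ) := by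
    intro t ht
    obtain ⟨x, hx, hxt⟩ := h.cover n t ht
    refine ⟨x, hx, ?_⟩
    change edist t x ≤ ε
    rw [edist_dist, Real.dist_eq, ← ENNReal.ofReal_coe_nnreal]
    exact ENNReal.ofReal_le_ofReal (hxt.trans hε)
  simpa using hc.externalCoveringNumber_le_encard

lemma le_externalCoveringNumber (h : IsRegularNet T r L R c K P) {ε : ℝ≥0} {n : ℕ}
    (hε : 2 * ε < c * r ^ n) : ((P n).card : ℕ∞) ≤ Metric.externalCoveringNumber ε T := by
  refine le_trans ?_ (Metric.packingNumber_two_mul_le_externalCoveringNumber ε T)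
  have hs : Metric.IsSeparated ((2 * ε : ℝ≥0) : ℝ≥0∞) (P n : Set ℝ) := by
    intro x hx y hy hxy
    rw [edist_dist, Real.dist_eq, ← ENNReal.ofReal_coe_nnreal]
    refine (ENNReal.ofReal_lt_ofReal_iff_of_nonneg (NNReal.coe_nonneg _)).2 ?_
    push_cast
    exact hε.trans_le (h.sep n x hx y hy hxy)
  have := hs.encard_le_packingNumber (A := T) (fun x hx => h.subset n x hx)
  simpa using this

/-- The covering numbers of a set with a regular net are comparable to `ε ^ (-d)`. -/
lemma exists_bounds_externalCoveringNumber (h : IsRegularNet T r L R c K P) :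
    ∃ A B : ℝ, 0 < A ∧ 0 < B ∧ ∀ᶠ ε : ℝ≥0 in 𝓝[>] 0,
      A * (1 / (ε : ℝ)) ^ Real.logb r⁻¹ L ≤ ((Metric.externalCoveringNumber ε T).toNat : ℝ) ∧
      ((Metric.externalCoveringNumber ε T).toNat : ℝ) ≤ B * (1 / (ε : ℝ)) ^ Real.logb r⁻¹ L := by
  have hr := h.r_pos
  have hR := h.R_pos
  have hcp := h.c_pos
  have hL := zero_lt_one.trans h.one_lt_L
  have hd := h.dim_pos
  set d := Real.logb r⁻¹ L
  refine ⟨(r * c / 4) ^ d, K * L * R ^ d, by positivity, by have := h.K_pos; positivity, ?_⟩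
  have hm : (0 : ℝ≥0) < min (Real.toNNReal R) (Real.toNNReal (c / 4)) := by
    simp [hR, hcp]
  filter_upwards [Ioo_mem_nhdsGT hm] with ε hε
  obtain ⟨hε0, hε1⟩ := hε
  have hε0' : (0 : ℝ) < ε := hε0
  have hεR : (ε : ℝ) < R := by
    have := hε1.trans_le (min_le_left _ _)
    exact Real.lt_toNNReal_iff_coe_lt.1 this
  have hεc : (ε : ℝ) < c / 4 := by
    have := hε1.trans_le (min_le_right _ _)
    exact Real.lt_toNNReal_iff_coe_lt.1 this
  obtain ⟨n, hn1, hn2⟩ := exists_nat_pow_near_of_lt_one (div_pos hε0' hR)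
    ((div_le_one hR).2 hεR.le) hr h.r_lt_one
  obtain ⟨m, hm1, hm2⟩ := exists_nat_pow_near_of_lt_one (x := 4 * ε / c) (by positivity)
    ((div_le_one hcp).2 (by linarith)) hr h.r_lt_one
  have hup := h.externalCoveringNumber_le (ε := ε) (n := n + 1) (by
    rw [lt_div_iff₀ hR] at hn1; linarith)
  have hlo := h.le_externalCoveringNumber (ε := ε) (n := m) (by
    rw [div_le_iff₀ hcp] at hm2; linarith)
  have htop : Metric.externalCoveringNumber ε T ≠ ⊤ := ne_top_of_le_ne_top (by simp) hup
  have hup' : ((Metric.externalCoveringNumber ε T).toNat : ℝ) ≤ (P (n + 1)).card := by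
    have := ENat.toNat_le_toNat hup (by simp)
    simp only [ENat.toNat_natCast] at this
    exact_mod_cast this
  have hlo' : ((P m).card : ℝ) ≤ ((Metric.externalCoveringNumber ε T).toNat : ℝ) := by
    have := ENat.toNat_le_toNat hlo htop
    simp only [ENat.toNat_natCast] at this
    exact_mod_cast this
  constructor
  · refine le_trans ?_ ((h.le_card m).trans hlo')
    have hLm : L ^ m = ((r ^ m)⁻¹) ^ d := by
      rw [Real.inv_rpow (by positivity), h.pow_rpow_dim, inv_inv]
    rw [hLm, ← Real.mul_rpow (by positivity) (by positivity)]
    refine Real.rpow_le_rpow (by positivity) ?_ hd.le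
    rw [le_inv_comm₀ (by positivity) (by positivity)]
    rw [pow_succ, lt_div_iff₀ hcp] at hm1
    rw [mul_one_div, inv_div, le_div_iff₀ (by positivity)]
    nlinarith
  · refine (hup'.trans (h.card_le _)).trans ?_
    have hLm : L ^ n = ((r ^ n)⁻¹) ^ d := by
      rw [Real.inv_rpow (by positivity), h.pow_rpow_dim, inv_inv]
    rw [pow_succ, hLm, mul_assoc K L, mul_assoc K, mul_assoc L, mul_comm _ L,
      ← Real.mul_rpow (by positivity) (by positivity)]
    have := h.K_pos
    gcongr
    rw [inv_le_comm₀ (by positivity) (by positivity), mul_one_div, inv_div]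
    exact hn2

/-- A set with a regular net has box dimension `log L / log (1 / r)`. -/
theorem hasBoxDimension (h : IsRegularNet T r L R c K P) :
    HasBoxDimension T (Real.logb r⁻¹ L) := by
  refine ⟨h.nonempty, ?_, ?_⟩
  · refine (Metric.isBounded_iff_subset_closedBall 0).2 ⟨R, fun t ht => ?_⟩
    simpa using h.abs_le t ht
  obtain ⟨A, B, hA, hB, hAB⟩ := h.exists_bounds_externalCoveringNumber
  set d := Real.logb r⁻¹ L
  have hlog : Tendsto (fun ε : ℝ≥0 => Real.log (1 / (ε : ℝ))) (𝓝[>] 0) atTop := by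
    have h1 : Tendsto (fun ε : ℝ≥0 => (ε : ℝ)) (𝓝[>] 0) (𝓝[>] 0) := by
      refine tendsto_nhdsWithin_iff.2 ⟨?_, ?_⟩
      · exact (NNReal.continuous_coe.tendsto 0).mono_left nhdsWithin_le_nhds
      · filter_upwards [self_mem_nhdsWithin] with ε hε
        exact_mod_cast hε
    have h2 := Real.tendsto_log_atTop.comp (tendsto_inv_nhdsGT_zero.comp h1)
    refine h2.congr fun ε => ?_
    simp
  have key (a : ℝ) : Tendsto (fun ε : ℝ≥0 => a / Real.log (1 / (ε : ℝ)) + d) (𝓝[>] 0) (𝓝 d) := by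
    simpa using (hlog.const_div_atTop a).add_const d
  refine tendsto_of_tendsto_of_tendsto_of_le_of_le' (key (Real.log A)) (key (Real.log B)) ?_ ?_
  · filter_upwards [hAB, hlog.eventually_gt_atTop 0, self_mem_nhdsWithin] with ε h1 h2 h3
    have h3' : (0 : ℝ) < 1 / ε := one_div_pos.2 h3
    rw [le_div_iff₀ h2, add_mul, div_mul_cancel₀ _ h2.ne', ← Real.log_rpow h3',
      ← Real.log_mul hA.ne' (by positivity)]
    exact Real.log_le_log (by positivity) h1.1
  · filter_upwards [hAB, hlog.eventually_gt_atTop 0, self_mem_nhdsWithin] with ε h1 h2 h3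
    have h3' : (0 : ℝ) < 1 / ε := one_div_pos.2 h3
    rw [div_le_iff₀ h2, add_mul, div_mul_cancel₀ _ h2.ne', ← Real.log_rpow h3',
      ← Real.log_mul hB.ne' (by positivity)]
    exact Real.log_le_log (lt_of_lt_of_le (by positivity) h1.1) h1.2

lemma dimH_le (h : IsRegularNet T r L R c K P) :
    dimH T ≤ ENNReal.ofReal (Real.logb r⁻¹ L) := by
  have hr := h.r_pos
  have hR := h.R_pos
  have hL := zero_lt_one.trans h.one_lt_L
  have hd := h.dim_pos
  set d := Real.logb r⁻¹ L
  refine dimH_le_of_hausdorffMeasure_ne_top 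
    (ne_top_of_le_ne_top (b := ENNReal.ofReal (K * (2 * R) ^ d)) (by simp) ?_)
  rw [Real.coe_toNNReal _ hd.le]
  have hdiam : ∀ n : ℕ, ∀ x : P n,
      Metric.ediam (Metric.closedBall (x : ℝ) (R * r ^ n)) ≤ ENNReal.ofReal (2 * R * r ^ n) := by
    intro n x
    have hpos : 0 ≤ R * r ^ n := by positivity
    rw [← Metric.closedEBall_ofReal hpos]
    refine Metric.ediam_closedEBall_le.trans_eq ?_
    rw [mul_assoc, ENNReal.ofReal_mul (by norm_num : (0 : ℝ) ≤ 2), ENNReal.ofReal_ofNat]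
  refine (MeasureTheory.Measure.hausdorffMeasure_le_liminf_sum (ι := fun n : ℕ => P n) d T
    (l := atTop) (fun n => ENNReal.ofReal (2 * R * r ^ n)) ?_
    (fun n x => Metric.closedBall (x : ℝ) (R * r ^ n)) (Eventually.of_forall hdiam) ?_).trans ?_
  · rw [← ENNReal.ofReal_zero]
    refine ENNReal.tendsto_ofReal ?_
    simpa using (tendsto_pow_atTop_nhds_zero_of_lt_one hr.le h.r_lt_one).const_mul (2 * R)
  · refine Eventually.of_forall fun n t ht => ?_
    obtain ⟨x, hx, hxt⟩ := h.cover n t ht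
    exact Set.mem_iUnion.2 ⟨⟨x, hx⟩, hxt⟩
  · refine liminf_le_of_frequently_le' (Frequently.of_forall fun n => ?_)
    calc ∑ x : P n, Metric.ediam (Metric.closedBall (x : ℝ) (R * r ^ n)) ^ d
        ≤ ∑ x : P n, ENNReal.ofReal (2 * R * r ^ n) ^ d :=
          Finset.sum_le_sum fun x _ => ENNReal.rpow_le_rpow (hdiam n x) hd.le
      _ = ENNReal.ofReal ((P n).card * (2 * R * r ^ n) ^ d) := by
          rw [Finset.sum_const, Finset.card_univ, Fintype.card_coe, nsmul_eq_mul,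
            ENNReal.ofReal_rpow_of_pos (by positivity), ENNReal.ofReal_mul (by positivity),
            ENNReal.ofReal_natCast]
      _ ≤ ENNReal.ofReal (K * (2 * R) ^ d) := by
          refine ENNReal.ofReal_le_ofReal ?_
          rw [Real.mul_rpow (by positivity) (by positivity), h.pow_rpow_dim]
          calc ((P n).card : ℝ) * ((2 * R) ^ d * (L ^ n)⁻¹)
              ≤ (K * L ^ n) * ((2 * R) ^ d * (L ^ n)⁻¹) := by
                gcongr; exact h.card_le n
            _ = K * (2 * R) ^ d := by field_simp

/-- The normalized counting function of the `n`-th net. -/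
noncomputable def countCDF (L : ℝ) (P : ℕ → Finset ℝ) (n : ℕ) (t : ℝ) : ℝ :=
  ((P n).filter fun x => x ≤ t).card / L ^ n

lemma countCDF_mem_Icc (h : IsRegularNet T r L R c K P) (n : ℕ) (t : ℝ) :
    countCDF L P n t ∈ Set.Icc 0 K := by
  have hL := zero_lt_one.trans h.one_lt_L
  refine ⟨by unfold countCDF; positivity, ?_⟩
  rw [countCDF, div_le_iff₀ (by positivity)]
  refine le_trans ?_ (h.card_le n)
  exact_mod_cast Finset.card_filter_le _ _

/-- A cluster value of the counting functions, chosen along one ultrafilter for all points at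
once. -/
lemma exists_limit_countCDF (h : IsRegularNet T r L R c K P) :
    ∃ F : ℝ → ℝ, ∀ t,
      Tendsto (fun n => countCDF L P n t) (hyperfilter ℕ : Filter ℕ) (𝓝 (F t)) := by
  have (t : ℝ) : ∃ y, Tendsto (fun n => countCDF L P n t) (hyperfilter ℕ : Filter ℕ) (𝓝 y) := by
    obtain ⟨y, -, hy⟩ := (isCompact_Icc (a := (0 : ℝ)) (b := K)).ultrafilter_le_nhds'
      ((hyperfilter ℕ).map fun n => countCDF L P n t)
      (Ultrafilter.mem_map.2 (univ_mem' fun n => h.countCDF_mem_Icc n t))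
    exact ⟨y, hy⟩
  choose F hF using this
  exact ⟨F, hF⟩

lemma countCDF_sub_le (h : IsRegularNet T r L R c K P) {k n : ℕ} (hkn : k ≤ n) {s t : ℝ}
    (hst' : t - s ≤ R * r ^ k) :
    countCDF L P n t - countCDF L P n s ≤ K * (L ^ k)⁻¹ := by
  have hL := zero_lt_one.trans h.one_lt_L
  obtain ⟨m, rfl⟩ := Nat.exists_eq_add_of_le hkn
  have hsub : (P (k + m)).filter (fun x => x ≤ t) ⊆
      (P (k + m)).filter (fun x => x ≤ s) ∪ (P (k + m)).filter (fun x => |x - t| ≤ R * r ^ k) := by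
    intro x hx
    rw [Finset.mem_filter] at hx
    rw [Finset.mem_union, Finset.mem_filter, Finset.mem_filter]
    rcases le_or_gt x s with hxs | hxs
    · exact Or.inl ⟨hx.1, hxs⟩
    · exact Or.inr ⟨hx.1, _root_.abs_le.2 ⟨by linarith, by
        have := h.r_pos; have := h.R_pos
        have : 0 < R * r ^ k := by positivity
        linarith [hx.2]⟩⟩
  have hcard : (((P (k + m)).filter (fun x => x ≤ t)).card : ℝ) ≤
      ((P (k + m)).filter (fun x => x ≤ s)).card + K * L ^ m := by
    refine le_trans ?_ (add_le_add_right (h.local_card k m t) _)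
    exact_mod_cast (Finset.card_le_card hsub).trans (Finset.card_union_le _ _)
  rw [countCDF, countCDF, ← sub_div, div_le_iff₀ (by positivity), pow_add]
  have : K * (L ^ k)⁻¹ * (L ^ k * L ^ m) = K * L ^ m := by field_simp
  rw [this]
  linarith

lemma countCDF_mono (hL : 0 < L) (n : ℕ) : Monotone (countCDF L P n) := by
  intro s t hst
  unfold countCDF
  gcongr

lemma abs_limit_sub_le (h : IsRegularNet T r L R c K P) {F : ℝ → ℝ}
    (hF : ∀ t, Tendsto (fun n => countCDF L P n t) (hyperfilter ℕ : Filter ℕ) (𝓝 (F t)))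
    {s t : ℝ} (hst : s ≤ t) :
    |F t - F s| ≤ K * (1 / (r * R)) ^ Real.logb r⁻¹ L * (t - s) ^ Real.logb r⁻¹ L := by
  have hr := h.r_pos
  have hR := h.R_pos
  have hK := h.K_pos
  have hL := zero_lt_one.trans h.one_lt_L
  have hd := h.dim_pos
  have hpow := h.pow_rpow_dim
  set d := Real.logb r⁻¹ L
  have hlim := (hF t).sub (hF s)
  have hnonneg : 0 ≤ F t - F s :=
    ge_of_tendsto' hlim fun n => sub_nonneg.2 (countCDF_mono hL n hst)
  rw [abs_of_nonneg hnonneg, mul_assoc, ← Real.mul_rpow (by positivity) (by linarith)]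
  rcases hst.eq_or_lt with rfl | hlt
  · rw [sub_self]
    positivity
  have hδ : 0 < t - s := sub_pos.2 hlt
  rcases le_or_gt ((t - s) / R) 1 with h1 | h1
  · obtain ⟨k, hk1, hk2⟩ := exists_nat_pow_near_of_lt_one (div_pos hδ hR) h1 hr h.r_lt_one
    have hle : F t - F s ≤ K * (L ^ k)⁻¹ := by
      refine le_of_tendsto hlim ?_
      filter_upwards [Nat.hyperfilter_le_atTop (eventually_ge_atTop k)] with n hn
      exact h.countCDF_sub_le hn (by rw [div_le_iff₀ hR] at hk2; linarith)
    refine hle.trans ?_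
    rw [← hpow]
    gcongr
    rw [pow_succ, lt_div_iff₀ hR] at hk1
    rw [one_div_mul_eq_div, le_div_iff₀ (by positivity)]
    nlinarith
  · have hle : F t - F s ≤ K := by
      refine le_of_tendsto' hlim fun n => ?_
      have h2 := (h.countCDF_mem_Icc n t).2
      have h3 := (h.countCDF_mem_Icc n s).1
      linarith
    refine hle.trans (le_mul_of_one_le_right hK.le (Real.one_le_rpow ?_ hd.le))
    rw [one_div_mul_eq_div, one_le_div (by positivity)]
    rw [one_lt_div hR] at h1
    nlinarith [h.r_lt_one]

lemma isCompact (h : IsRegularNet T r L R c K P) (hT : IsClosed T) : IsCompact T :=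
  (isCompact_closedBall (0 : ℝ) R).of_isClosed_subset hT fun t ht => by
    simpa using h.abs_le t ht

/-- A limit of the counting functions maps `T` onto a set containing `(0, 1)`: it takes every value
in between by continuity, and it is constant on the gaps of `T`. -/
lemma Ioo_subset_image_limit (h : IsRegularNet T r L R c K P) (hT : IsClosed T) {F : ℝ → ℝ}
    (hF : ∀ t, Tendsto (fun n => countCDF L P n t) (hyperfilter ℕ : Filter ℕ) (𝓝 (F t)))
    (hcont : Continuous F) : Set.Ioo 0 1 ⊆ F '' T := by
  have hL := zero_lt_one.trans h.one_lt_L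
  have hR := h.R_pos
  -- No point of the nets lies below `-R - 1`, and all of them lie below `R`.
  have hlo : F (-R - 1) = 0 := by
    refine tendsto_nhds_unique (hF _) (tendsto_const_nhds.congr fun n => ?_)
    rw [countCDF, Finset.filter_false_of_mem, Finset.card_empty, Nat.cast_zero, zero_div]
    intro x hx hxR
    have := _root_.abs_le.1 (h.abs_le x (h.subset n x hx))
    linarith
  have hhi : 1 ≤ F R := by
    refine ge_of_tendsto' (hF _) fun n => ?_
    rw [countCDF, Finset.filter_true_of_mem, one_le_div (by positivity)]
    · exact h.le_card n
    · exact fun x hx => (_root_.abs_le.1 (h.abs_le x (h.subset n x hx))).2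
  intro y hy
  obtain ⟨t, -, rfl⟩ := intermediate_value_Icc (by linarith : -R - 1 ≤ R) hcont.continuousOn
    ⟨hlo.trans_le hy.1.le, hy.2.le.trans hhi⟩
  rcases (T ∩ Set.Iic t).eq_empty_or_nonempty with hempty | hne
  · have : F t = 0 := by
      refine tendsto_nhds_unique (hF _) (tendsto_const_nhds.congr fun n => ?_)
      rw [countCDF, Finset.filter_false_of_mem, Finset.card_empty, Nat.cast_zero, zero_div]
      intro x hx hxt
      exact Set.eq_empty_iff_forall_notMem.1 hempty x ⟨h.subset n x hx, hxt⟩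
    exact absurd this hy.1.ne'
  · obtain ⟨u, ⟨huT, hut⟩, hu⟩ := ((h.isCompact hT).inter_right isClosed_Iic).exists_isGreatest hne
    refine ⟨u, huT, tendsto_nhds_unique (hF u) ((hF t).congr fun n => ?_)⟩
    have heq : (P n).filter (fun x => x ≤ t) = (P n).filter (fun x => x ≤ u) :=
      Finset.filter_congr fun x hx =>
        ⟨fun hxt => hu ⟨h.subset n x hx, hxt⟩, fun hxu => hxu.trans hut⟩
    rw [countCDF, countCDF, heq]

/-- A limit of the counting functions is a Hölder map of exponent `d = log L / log (1 / r)` whose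
image of `T` has dimension `1`, so `T` has dimension at least `d`. -/
lemma le_dimH (h : IsRegularNet T r L R c K P) (hT : IsClosed T) :
    ENNReal.ofReal (Real.logb r⁻¹ L) ≤ dimH T := by
  obtain ⟨F, hF⟩ := h.exists_limit_countCDF
  have hd := h.dim_pos
  have hr := h.r_pos
  have hR := h.R_pos
  have hK := h.K_pos
  have hbound := fun {s t : ℝ} => h.abs_limit_sub_le hF (s := s) (t := t)
  set d := Real.logb r⁻¹ L
  have hC : 0 ≤ K * (1 / (r * R)) ^ d := by positivity
  have habs (s t : ℝ) : |F s - F t| ≤ K * (1 / (r * R)) ^ d * |s - t| ^ d := by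
    rcases le_total s t with hst | hst
    · rw [abs_sub_comm, abs_sub_comm s, abs_of_nonneg (sub_nonneg.2 hst)]
      exact hbound hst
    · rw [abs_of_nonneg (sub_nonneg.2 hst)]
      exact hbound hst
  have hholder : HolderWith (K * (1 / (r * R)) ^ d).toNNReal d.toNNReal F := by
    intro s t
    rw [edist_dist, edist_dist, Real.dist_eq, Real.dist_eq, Real.coe_toNNReal _ hd.le,
      ENNReal.ofReal_rpow_of_nonneg (abs_nonneg _) hd.le, ← ENNReal.ofReal,
      ← ENNReal.ofReal_mul hC]
    exact ENNReal.ofReal_le_ofReal (habs s t)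
  have hd' : 0 < d.toNNReal := by simpa using hd
  have h1 : (1 : ℝ≥0∞) ≤ dimH (F '' T) := by
    have h2 := dimH_mono (h.Ioo_subset_image_limit hT hF (hholder.continuous hd'))
    rw [Real.dimH_of_nonempty_interior (by rw [interior_Ioo]; simp)] at h2
    simpa using h2
  have h3 := h1.trans (hholder.dimH_image_le hd' T)
  rw [ENNReal.le_div_iff_mul_le (Or.inl (by simpa using hd)) (Or.inl (by simp)), one_mul] at h3
  exact h3

/-- A closed set with a regular net has Hausdorff dimension `log L / log (1 / r)`. -/
theorem dimH_eq (h : IsRegularNet T r L R c K P) (hT : IsClosed T) :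
    dimH T = ENNReal.ofReal (Real.logb r⁻¹ L) :=
  le_antisymm h.dimH_le (h.le_dimH hT)

end IsRegularNet

/-! ### Golden integers -/

/-- The golden integer `a + b γ` represented by `(a, b)`, as a real number. -/
noncomputable def goldenVal : ℤ × ℤ →+ ℝ where
  toFun x := x.1 + x.2 * Real.goldenRatio
  map_zero' := by simp
  map_add' x y := by push_cast [Prod.fst_add, Prod.snd_add]; ring

/-- The algebraic conjugate of the golden integer represented by `(a, b)`. -/
noncomputable def goldenConjVal : ℤ × ℤ →+ ℝ where
  toFun x := x.1 + x.2 * Real.goldenConj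
  map_zero' := by simp
  map_add' x y := by push_cast [Prod.fst_add, Prod.snd_add]; ring

/-- Multiplication by the unit `γ ^ 6 = 5 + 8 γ`. -/
def mulUnit : ℤ × ℤ →+ ℤ × ℤ where
  toFun x := (5 * x.1 + 8 * x.2, 8 * x.1 + 13 * x.2)
  map_zero' := by simp
  map_add' x y := by ext <;> simp <;> ring

lemma goldenVal_apply (x : ℤ × ℤ) : goldenVal x = x.1 + x.2 * Real.goldenRatio := rfl

lemma goldenConjVal_apply (x : ℤ × ℤ) : goldenConjVal x = x.1 + x.2 * Real.goldenConj := rfl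

lemma mulUnit_apply (x : ℤ × ℤ) :
    mulUnit x = (5 * x.1 + 8 * x.2, 8 * x.1 + 13 * x.2) := rfl

lemma goldenRatio_pow_six : Real.goldenRatio ^ 6 = 5 + 8 * Real.goldenRatio := by
  have h := Real.goldenRatio_sq
  linear_combination (Real.goldenRatio ^ 4 + Real.goldenRatio ^ 3 + 2 * Real.goldenRatio ^ 2 +
    3 * Real.goldenRatio + 5) * h

lemma goldenConj_pow_six : Real.goldenConj ^ 6 = 5 + 8 * Real.goldenConj := by
  have h := Real.goldenConj_sq
  linear_combination (Real.goldenConj ^ 4 + Real.goldenConj ^ 3 + 2 * Real.goldenConj ^ 2 +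
    3 * Real.goldenConj + 5) * h

lemma goldenVal_mulUnit (x : ℤ × ℤ) :
    goldenVal (mulUnit x) = Real.goldenRatio ^ 6 * goldenVal x := by
  rw [goldenRatio_pow_six, goldenVal_apply, goldenVal_apply, mulUnit_apply]
  push_cast
  linear_combination (-8 * (x.2 : ℝ)) * Real.goldenRatio_sq

lemma goldenConjVal_mulUnit (x : ℤ × ℤ) :
    goldenConjVal (mulUnit x) = Real.goldenConj ^ 6 * goldenConjVal x := by
  rw [goldenConj_pow_six, goldenConjVal_apply, goldenConjVal_apply, mulUnit_apply]
  push_cast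
  linear_combination (-8 * (x.2 : ℝ)) * Real.goldenConj_sq

lemma goldenRatio_gt : (1.618 : ℝ) < Real.goldenRatio := by
  have : (2.236 : ℝ) < √5 := Real.lt_sqrt_of_sq_lt (by norm_num)
  rw [Real.goldenRatio]; linarith

lemma goldenRatio_lt : Real.goldenRatio < (1.6181 : ℝ) := by
  have : √5 < (2.2362 : ℝ) := (Real.sqrt_lt' (by norm_num)).2 (by norm_num)
  rw [Real.goldenRatio]; linarith

lemma goldenConj_eq : Real.goldenConj = 1 - Real.goldenRatio := by
  linarith [Real.goldenRatio_add_goldenConj]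

/-! ### The digit set and its iterated sums -/

/-- The digits `γ ^ 4 (ε₀ - δ₀) + γ ε₁ - γ ^ 2 δ₁ - δ₂` with `εᵢ, δᵢ ∈ {0, 1}`, as a sum of five
two-element sets. -/
def digits : Finset (ℤ × ℤ) :=
  {0, (2, 3)} + {0, (0, 1)} + {0, (-2, -3)} + {0, (-1, -1)} + {0, (-1, 0)}

/-- The sums `∑_{k < n} γ ^ (6 k) d_k` with digits `d_k`. -/
def digitSums : ℕ → Finset (ℤ × ℤ)
  | 0 => {0}
  | n + 1 => (digitSums n).image mulUnit + digits

lemma mem_digitSums_succ {n : ℕ} {x : ℤ × ℤ} :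
    x ∈ digitSums (n + 1) ↔ ∃ y ∈ digitSums n, ∃ d ∈ digits, mulUnit y + d = x := by
  rw [digitSums, Finset.mem_add]
  constructor
  · rintro ⟨z, hz, d, hd, rfl⟩
    obtain ⟨y, hy, rfl⟩ := Finset.mem_image.1 hz
    exact ⟨y, hy, d, hd, rfl⟩
  · rintro ⟨y, hy, d, hd, rfl⟩
    exact ⟨_, Finset.mem_image_of_mem _ hy, d, hd, rfl⟩

/-- Integer form of the bounds `-10.473 ≤ d ≤ 8.473` and `-2.147 ≤ d' ≤ 0.147` for a digit `d` with
conjugate `d'`. -/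
lemma digits_bounds : ∀ d ∈ digits, -4 ≤ d.2 ∧ d.2 ≤ 4 ∧
    -10472 ≤ 1000 * d.1 + 1618 * d.2 ∧ 1000 * d.1 + 1618 * d.2 ≤ 8472 ∧
    -2147 ≤ 1000 * d.1 - 618 * d.2 ∧ 1000 * d.1 - 618 * d.2 ≤ 147 := by
  decide +kernel

lemma goldenVal_digit_mem {d : ℤ × ℤ} (hd : d ∈ digits) :
    goldenVal d ∈ Set.Icc (-10.473) (8.473) := by
  obtain ⟨h1, h2, h3, h4, -, -⟩ := digits_bounds d hd
  have := goldenRatio_gt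
  have := goldenRatio_lt
  rify at h1 h2 h3 h4
  rw [goldenVal_apply]
  constructor <;> nlinarith

lemma goldenConjVal_digit_mem {d : ℤ × ℤ} (hd : d ∈ digits) :
    goldenConjVal d ∈ Set.Icc (-2.148) (0.148) := by
  obtain ⟨h1, h2, -, -, h3, h4⟩ := digits_bounds d hd
  have := goldenRatio_gt
  have := goldenRatio_lt
  rify at h1 h2 h3 h4
  rw [goldenConjVal_apply, goldenConj_eq]
  constructor <;> nlinarith

lemma goldenConjVal_digitSums_mem (n : ℕ) :
    ∀ x ∈ digitSums n, goldenConjVal x ∈ Set.Icc (-2.28) (0.16) := by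
  induction n with
  | zero =>
    intro x hx
    obtain rfl : x = 0 := by simpa [digitSums] using hx
    rw [map_zero]
    constructor <;> norm_num
  | succ n ih =>
    intro x hx
    obtain ⟨y, hy, d, hd, rfl⟩ := mem_digitSums_succ.1 hx
    obtain ⟨h1, h2⟩ := ih y hy
    obtain ⟨h3, h4⟩ := goldenConjVal_digit_mem hd
    rw [map_add, goldenConjVal_mulUnit, goldenConj_pow_six, goldenConj_eq]
    have := goldenRatio_gt
    have := goldenRatio_lt
    constructor <;> nlinarith

/-- The golden integers `0, ±1, ±γ⁻¹`: the possible small differences of digit sums. -/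
def smallDiffs : Finset (ℤ × ℤ) := {0, (1, 0), (-1, 1), (-1, 0), (1, -1)}

/-- A golden integer which is small together with its conjugate is one of `0, ±1, ±γ⁻¹`. -/
lemma mem_smallDiffs {z : ℤ × ℤ} (h1 : |goldenVal z| ≤ 1.12) (h2 : |goldenConjVal z| ≤ 2.44) :
    z ∈ smallDiffs := by
  obtain ⟨u, v⟩ := z
  rw [goldenVal_apply, abs_le] at h1
  rw [goldenConjVal_apply, goldenConj_eq, abs_le] at h2
  have hγ := goldenRatio_gt
  have hγ' := goldenRatio_lt
  simp only at h1 h2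
  have hv1 : (v : ℝ) < 2 := by nlinarith
  have hv2 : (-2 : ℝ) < v := by nlinarith
  have hv1' : v < 2 := by exact_mod_cast hv1
  have hv2' : -2 < v := by exact_mod_cast hv2
  obtain rfl | rfl | rfl : v = -1 ∨ v = 0 ∨ v = 1 := by omega
  all_goals
    push_cast at h1 h2
  · have hu1 : (0 : ℝ) < u := by linarith
    have hu2 : (u : ℝ) < 2 := by linarith
    have hu1' : 0 < u := by exact_mod_cast hu1
    have hu2' : u < 2 := by exact_mod_cast hu2
    obtain rfl : u = 1 := by omega
    decide
  · have hu1 : (-2 : ℝ) < u := by linarith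
    have hu2 : (u : ℝ) < 2 := by linarith
    have hu1' : -2 < u := by exact_mod_cast hu1
    have hu2' : u < 2 := by exact_mod_cast hu2
    obtain rfl | rfl | rfl : u = -1 ∨ u = 0 ∨ u = 1 := by omega
    all_goals decide
  · have hu1 : (-2 : ℝ) < u := by linarith
    have hu2 : (u : ℝ) < 0 := by linarith
    have hu1' : -2 < u := by exact_mod_cast hu1
    have hu2' : u < 0 := by exact_mod_cast hu2
    obtain rfl : u = -1 := by omega
    decide

/-- Digit sums have bounded conjugates, so two of them differ by `0`, `±1` or `±γ⁻¹` as soon as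
they are close. -/
lemma sub_mem_smallDiffs {n : ℕ} {x y : ℤ × ℤ} (hx : x ∈ digitSums n) (hy : y ∈ digitSums n)
    (h : |goldenVal (x - y)| ≤ 1.12) : x - y ∈ smallDiffs := by
  refine mem_smallDiffs h ?_
  obtain ⟨h1, h2⟩ := goldenConjVal_digitSums_mem n x hx
  obtain ⟨h3, h4⟩ := goldenConjVal_digitSums_mem n y hy
  rw [map_sub, abs_le]
  constructor <;> linarith

lemma half_le_abs_goldenVal {z : ℤ × ℤ} (hz : z ∈ smallDiffs) (h0 : z ≠ 0) :
    1 / 2 ≤ |goldenVal z| := by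
  have := goldenRatio_gt
  simp only [smallDiffs, Finset.mem_insert, Finset.mem_singleton] at hz
  rcases hz with rfl | rfl | rfl | rfl | rfl
  · exact absurd rfl h0
  · rw [goldenVal_apply]; norm_num
  · rw [goldenVal_apply, le_abs]; left; push_cast; linarith
  · rw [goldenVal_apply]; norm_num
  · rw [goldenVal_apply, le_abs]; right; push_cast; linarith

lemma half_le_abs_sub {n : ℕ} {x y : ℤ × ℤ} (hx : x ∈ digitSums n) (hy : y ∈ digitSums n)
    (hxy : x ≠ y) : 1 / 2 ≤ |goldenVal x - goldenVal y| := by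
  rw [← map_sub]
  rcases le_or_gt |goldenVal (x - y)| 1.12 with h | h
  · exact half_le_abs_goldenVal (sub_mem_smallDiffs hx hy h) (sub_ne_zero.2 hxy)
  · linarith

/-! ### Counting digit sums -/

/-- The number of elements of `S` which remain in `S` after translation by `t`. -/
def overlap (S : Finset (ℤ × ℤ)) (t : ℤ × ℤ) : ℕ := (S.filter fun x => x + t ∈ S).card

/-- Overlaps of a finite set with its translates are counted by sumsets with a pair. -/
lemma card_add_pair (S : Finset (ℤ × ℤ)) {t : ℤ × ℤ} :
    (S + {0, t}).card + overlap S (-t) = 2 * S.card := by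
  have h1 : S + {0, t} = S ∪ S.image (· + t) := by
    ext x
    simp only [Finset.mem_add, Finset.mem_insert, Finset.mem_singleton, Finset.mem_union,
      Finset.mem_image]
    constructor
    · rintro ⟨y, hy, z, rfl | rfl, rfl⟩
      · exact Or.inl (by rwa [add_zero])
      · exact Or.inr ⟨y, hy, rfl⟩
    · rintro (hx | ⟨y, hy, rfl⟩)
      · exact ⟨x, hx, 0, Or.inl rfl, add_zero x⟩
      · exact ⟨y, hy, t, Or.inr rfl, rfl⟩
  have h2 : S.filter (fun x => x + -t ∈ S) = S ∩ S.image (· + t) := by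
    ext x
    simp only [Finset.mem_filter, Finset.mem_inter, Finset.mem_image]
    refine and_congr_right fun _ => ⟨fun h => ⟨_, h, by abel⟩, ?_⟩
    rintro ⟨y, hy, rfl⟩
    rwa [add_neg_cancel_right]
  rw [overlap, h1, h2, Finset.card_union_add_card_inter,
    Finset.card_image_of_injective _ (add_left_injective t)]
  ring

lemma goldenRatio_pow_six_gt : (17.94 : ℝ) < Real.goldenRatio ^ 6 := by
  rw [goldenRatio_pow_six]; linarith [goldenRatio_gt]

/-- The size of `γ ^ 6 X + E` when the close pairs of `X` are those at distance `1` or `γ⁻¹`: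
a sum with several representations has exactly two of them, coming from such a pair. -/
lemma card_image_mulUnit_add {X E : Finset (ℤ × ℤ)}
    (hX : ∀ x ∈ X, ∀ y ∈ X, |goldenVal (x - y)| ≤ 1.12 → x - y ∈ smallDiffs)
    (hE : ∀ e ∈ E, ∀ f ∈ E, |goldenVal (e - f)| ≤ 20) :
    (X.image mulUnit + E).card + (overlap X (-(1, 0)) * overlap E (mulUnit (1, 0)) +
      overlap X (-(-1, 1)) * overlap E (mulUnit (-1, 1))) = X.card * E.card := by
  set R : ℤ × ℤ → Finset ((ℤ × ℤ) × (ℤ × ℤ)) := fun t =>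
    (X.filter fun x => x + -t ∈ X) ×ˢ (E.filter fun e => e + mulUnit t ∈ E) with hR
  have hmemR {t x e : ℤ × ℤ} : (x, e) ∈ R t ↔
      (x ∈ X ∧ x + -t ∈ X) ∧ (e ∈ E ∧ e + mulUnit t ∈ E) := by
    simp only [hR, Finset.mem_product, Finset.mem_filter]
  have hcoll : ∀ x ∈ X, ∀ y ∈ X, ∀ e ∈ E, ∀ f ∈ E, mulUnit x + e = mulUnit y + f →
      x - y ∈ smallDiffs := by
    intro x hx y hy e he f hf h
    refine hX x hx y hy ?_
    have h1 : mulUnit (x - y) = f - e := by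
      rw [map_sub, sub_eq_sub_iff_add_eq_add, h, add_comm]
    have h2 := hE f hf e he
    rw [← h1, goldenVal_mulUnit, abs_mul, abs_of_pos (by positivity)] at h2
    have := goldenRatio_pow_six_gt
    have := abs_nonneg (goldenVal (x - y))
    nlinarith
  have hdisj : Disjoint (R (1, 0)) (R (-1, 1)) := by
    rw [Finset.disjoint_left]
    rintro ⟨x, e⟩ h1 h2
    rw [hmemR] at h1 h2
    have h3 := hcoll _ h1.1.2 _ h2.1.2 _ h1.2.2 _ h2.2.2 (by
      simp only [map_add, map_neg]; abel)
    have h4 : x + -(1, 0) - (x + -(-1, 1)) = ((-2, 1) : ℤ × ℤ) := by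
      rw [add_sub_add_left_eq_sub]; rfl
    rw [h4] at h3
    exact absurd h3 (by decide)
  have hsub : R (1, 0) ∪ R (-1, 1) ⊆ X ×ˢ E := by
    rintro ⟨x, e⟩ h
    rw [Finset.mem_union, hmemR, hmemR] at h
    rw [Finset.mem_product]
    rcases h with h | h <;> exact ⟨h.1.1, h.2.1⟩
  have hmem_union {p : (ℤ × ℤ) × (ℤ × ℤ)} (h : p ∈ R (1, 0) ∪ R (-1, 1)) :
      ∃ t ∈ ({(1, 0), (-1, 1)} : Finset (ℤ × ℤ)), p ∈ R t := by
    rcases Finset.mem_union.1 h with h | h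
    · exact ⟨_, by decide, h⟩
    · exact ⟨_, by decide, h⟩
  have himage : X.image mulUnit + E =
      ((X ×ˢ E) \ (R (1, 0) ∪ R (-1, 1))).image fun p => mulUnit p.1 + p.2 := by
    ext y
    constructor
    · intro hy
      obtain ⟨z, hz, e, he, rfl⟩ := Finset.mem_add.1 hy
      obtain ⟨x, hx, rfl⟩ := Finset.mem_image.1 hz
      by_cases h : (x, e) ∈ R (1, 0) ∪ R (-1, 1)
      · obtain ⟨t, ht, htR⟩ := hmem_union h
        rw [hmemR] at htR
        -- The representation moved along the close pair is not removed.
        refine Finset.mem_image.2 ⟨(x + -t, e + mulUnit t), Finset.mem_sdiff.2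
          ⟨Finset.mem_product.2 ⟨htR.1.2, htR.2.2⟩, fun h' => ?_⟩, ?_⟩
        · obtain ⟨s, hs, hsR⟩ := hmem_union h'
          rw [hmemR] at hsR
          have h3 := hcoll x hx _ hsR.1.2 e he _ hsR.2.2 (by
            simp only [map_add, map_neg]; abel)
          have h4 : x - (x + -t + -s) = t + s := by abel
          rw [h4] at h3
          have h5 : ∀ t ∈ ({(1, 0), (-1, 1)} : Finset (ℤ × ℤ)),
              ∀ s ∈ ({(1, 0), (-1, 1)} : Finset (ℤ × ℤ)), t + s ∉ smallDiffs := by decide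
          exact h5 t ht s hs h3
        · simp only [map_add, map_neg]; abel
      · exact Finset.mem_image.2
          ⟨(x, e), Finset.mem_sdiff.2 ⟨Finset.mem_product.2 ⟨hx, he⟩, h⟩, rfl⟩
    · intro hy
      obtain ⟨p, hp, rfl⟩ := Finset.mem_image.1 hy
      obtain ⟨hx, he⟩ := Finset.mem_product.1 (Finset.mem_sdiff.1 hp).1
      exact Finset.add_mem_add (Finset.mem_image_of_mem _ hx) he
  have hinj : Set.InjOn (fun p : (ℤ × ℤ) × (ℤ × ℤ) => mulUnit p.1 + p.2)
      ((X ×ˢ E) \ (R (1, 0) ∪ R (-1, 1)) : Finset _) := by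
    rintro ⟨x, e⟩ hp ⟨y, f⟩ hq h
    simp only [Finset.coe_sdiff, Set.mem_sdiff, Finset.mem_coe, Finset.mem_product,
      Finset.mem_union, not_or, hmemR] at hp hq h
    obtain ⟨⟨hx, he⟩, hp1, hp2⟩ := hp
    obtain ⟨⟨hy, hf⟩, hq1, hq2⟩ := hq
    have hxy (t : ℤ × ℤ) (ht : x - y = t) : x + -t = y ∧ e + mulUnit t = f := by
      subst ht
      refine ⟨by abel, ?_⟩
      rw [map_sub, ← sub_eq_zero, ← sub_eq_zero.2 h]; abel
    have hyx (t : ℤ × ℤ) (ht : x - y = -t) : y + -t = x ∧ f + mulUnit t = e := by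
      obtain ⟨h1, h2⟩ := hxy _ ht
      rw [← h1, ← h2, map_neg]
      exact ⟨by abel, by abel⟩
    have h3 := hcoll x hx y hy e he f hf h
    simp only [smallDiffs, Finset.mem_insert, Finset.mem_singleton] at h3
    rcases h3 with h3 | h3 | h3 | h3 | h3
    · obtain ⟨h4, h5⟩ := hxy _ h3
      rw [map_zero, add_zero] at h5
      rw [neg_zero, add_zero] at h4
      rw [h4, h5]
    · obtain ⟨h4, h5⟩ := hxy _ h3
      exact absurd ⟨⟨hx, h4 ▸ hy⟩, he, h5 ▸ hf⟩ hp1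
    · obtain ⟨h4, h5⟩ := hxy _ h3
      exact absurd ⟨⟨hx, h4 ▸ hy⟩, he, h5 ▸ hf⟩ hp2
    · obtain ⟨h4, h5⟩ := hyx (1, 0) h3
      exact absurd ⟨⟨hy, h4 ▸ hx⟩, hf, h5 ▸ he⟩ hq1
    · obtain ⟨h4, h5⟩ := hyx (-1, 1) (h3.trans (by decide))
      exact absurd ⟨⟨hy, h4 ▸ hx⟩, hf, h5 ▸ he⟩ hq2
  have hcard : (R (1, 0) ∪ R (-1, 1)).card = overlap X (-(1, 0)) * overlap E (mulUnit (1, 0)) +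
      overlap X (-(-1, 1)) * overlap E (mulUnit (-1, 1)) := by
    rw [Finset.card_union_of_disjoint hdisj, Finset.card_product, Finset.card_product]
    rfl
  rw [himage, Finset.card_image_of_injOn hinj, ← hcard,
    Finset.card_sdiff_add_card_eq_card hsub, Finset.card_product]

/-- The digits spread over less than `19`, so there is room for a further spread of `1` in
`card_image_mulUnit_add`. -/
lemma card_digitSums_succ_add (n : ℕ) {F : Finset (ℤ × ℤ)}
    (hF : ∀ f ∈ F, goldenVal f ∈ Set.Icc 0 1) :
    (digitSums (n + 1) + F).card +
      (overlap (digitSums n) (-(1, 0)) * overlap (digits + F) (mulUnit (1, 0)) +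
        overlap (digitSums n) (-(-1, 1)) * overlap (digits + F) (mulUnit (-1, 1))) =
      (digitSums n).card * (digits + F).card := by
  rw [digitSums, add_assoc]
  refine card_image_mulUnit_add (fun x hx y hy => sub_mem_smallDiffs hx hy) ?_
  intro e he f hf
  obtain ⟨d, hd, s, hs, rfl⟩ := Finset.mem_add.1 he
  obtain ⟨d', hd', s', hs', rfl⟩ := Finset.mem_add.1 hf
  obtain ⟨h1, h2⟩ := goldenVal_digit_mem hd
  obtain ⟨h3, h4⟩ := goldenVal_digit_mem hd'
  obtain ⟨h5, h6⟩ := hF s hs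
  obtain ⟨h7, h8⟩ := hF s' hs'
  rw [map_sub, map_add, map_add, abs_le]
  constructor <;> linarith

lemma card_digitSums_succ (n : ℕ) :
    (digitSums (n + 1)).card + (overlap (digitSums n) (-(1, 0)) * 2 +
      overlap (digitSums n) (-(-1, 1)) * 8) = (digitSums n).card * 21 := by
  have h := card_digitSums_succ_add n (F := {0}) (by simp)
  have e1 : overlap (digits + {0}) (mulUnit (1, 0)) = 2 := by decide +kernel
  have e2 : overlap (digits + {0}) (mulUnit (-1, 1)) = 8 := by decide +kernel
  have e3 : (digits + {0}).card = 21 := by decide +kernel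
  rw [e1, e2, e3] at h
  rwa [Finset.singleton_zero, add_zero] at h

lemma overlap_digitSums_succ_one (n : ℕ) :
    overlap (digitSums (n + 1)) (-(1, 0)) + (overlap (digitSums n) (-(1, 0)) +
      4 * overlap (digitSums n) (-(-1, 1))) = 12 * (digitSums n).card := by
  have h := card_digitSums_succ_add n (F := {0, (1, 0)}) (by
    simp [goldenVal_apply])
  have e1 : overlap (digits + {0, (1, 0)}) (mulUnit (1, 0)) = 3 := by decide +kernel
  have e2 : overlap (digits + {0, (1, 0)}) (mulUnit (-1, 1)) = 12 := by decide +kernel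
  have e3 : (digits + {0, (1, 0)}).card = 30 := by decide +kernel
  rw [e1, e2, e3] at h
  have h' := card_add_pair (digitSums (n + 1)) (t := (1, 0))
  have h'' := card_digitSums_succ n
  omega

lemma overlap_digitSums_succ_inv (n : ℕ) :
    overlap (digitSums (n + 1)) (-(-1, 1)) + overlap (digitSums n) (-(-1, 1)) =
      6 * (digitSums n).card := by
  have h := card_digitSums_succ_add n (F := {0, (-1, 1)}) (by
    have := goldenRatio_gt
    have := goldenRatio_lt
    simp only [Finset.mem_insert, Finset.mem_singleton, forall_eq_or_imp, forall_eq, map_zero]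
    rw [goldenVal_apply]
    push_cast
    refine ⟨by simp, ?_, ?_⟩ <;> linarith)
  have e1 : overlap (digits + {0, (-1, 1)}) (mulUnit (1, 0)) = 4 := by decide +kernel
  have e2 : overlap (digits + {0, (-1, 1)}) (mulUnit (-1, 1)) = 15 := by decide +kernel
  have e3 : (digits + {0, (-1, 1)}).card = 36 := by decide +kernel
  rw [e1, e2, e3] at h
  have h' := card_add_pair (digitSums (n + 1)) (t := (-1, 1))
  have h'' := card_digitSums_succ n
  omega

/-- With `N` the number of digit sums of length `n` and `a`, `b` the numbers of those `x` with `x - 1`,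
respectively `x - γ⁻¹`, among them, the recursion is `N' = 21 N - 2 a - 8 b`, `a' = 12 N - a - 4 b`,
`b' = 6 N - b`. Its characteristic polynomial is the cubic, and the combination of `N`, `a`, `b` below
is the left eigenvector for the root `L`. -/
lemma card_digitSums_eigen {L : ℝ} (hL : L ^ 3 - 19 * L ^ 2 + 31 * L + 3 = 0) (hL' : 0 < L)
    (n : ℕ) : ((digitSums n).card : ℝ) - 2 / (L + 1) * overlap (digitSums n) (-(1, 0)) -
      8 * L / (L + 1) ^ 2 * overlap (digitSums n) (-(-1, 1)) = L ^ n := by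
  induction n with
  | zero =>
    have h1 : overlap (digitSums 0) (-(1, 0)) = 0 := by decide
    have h2 : overlap (digitSums 0) (-(-1, 1)) = 0 := by decide
    have h3 : (digitSums 0).card = 1 := by decide
    rw [h1, h2, h3]
    simp
  | succ n ih =>
    have h1 := card_digitSums_succ n
    have h2 := overlap_digitSums_succ_one n
    have h3 := overlap_digitSums_succ_inv n
    rify at h1 h2 h3
    have h0 : L + 1 ≠ 0 := by positivity
    rw [pow_succ L n, ← ih, eq_sub_of_add_eq h1, eq_sub_of_add_eq h2, eq_sub_of_add_eq h3]
    field_simp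
    generalize ((digitSums n).card : ℝ) = N
    linear_combination (-N) * hL

lemma overlap_le_card (S : Finset (ℤ × ℤ)) (t : ℤ × ℤ) : overlap S t ≤ S.card :=
  Finset.card_filter_le _ _

lemma pow_le_card_digitSums {L : ℝ} (hL : L ^ 3 - 19 * L ^ 2 + 31 * L + 3 = 0) (hL' : 0 < L)
    (n : ℕ) : L ^ n ≤ (digitSums n).card := by
  rw [← card_digitSums_eigen hL hL' n, sub_sub]
  exact sub_le_self _ (by positivity)

lemma card_digitSums_le {L : ℝ} (hL : L ^ 3 - 19 * L ^ 2 + 31 * L + 3 = 0) (hL' : 17 < L)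
    (n : ℕ) : ((digitSums n).card : ℝ) ≤ 3 * L ^ n := by
  have h := card_digitSums_eigen hL (by linarith) n
  have h1 : (overlap (digitSums n) (-(1, 0)) : ℝ) ≤ (digitSums n).card := by
    exact_mod_cast overlap_le_card _ _
  have h2 : (overlap (digitSums n) (-(-1, 1)) : ℝ) ≤ (digitSums n).card := by
    exact_mod_cast overlap_le_card _ _
  have h3 : 2 / (L + 1) ≤ 1 / 9 := by rw [div_le_div_iff₀] <;> linarith
  have h4 : 8 * L / (L + 1) ^ 2 ≤ 1 / 2 := by rw [div_le_div_iff₀] <;> nlinarith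
  have h5 := mul_le_mul h3 h1 (by positivity) (by norm_num)
  have h6 := mul_le_mul h4 h2 (by positivity) (by norm_num)
  rw [← h]
  linarith

/-! ### Middle Cantor sets -/

section MiddleCantor

variable {α : ℝ}

lemma middleCantor_subset_Icc_union : middleCantor α ⊆ Set.Icc 0 α ∪ Set.Icc (1 - α) 1 :=
  fun _ hx => hx 0

lemma mem_middleCantor_iff {x : ℝ} : x ∈ middleCantor α ↔
    x ∈ Set.Icc 0 α ∪ Set.Icc (1 - α) 1 ∧ middleCantorMap α x ∈ middleCantor α := by
  constructor
  · exact fun hx => ⟨hx 0, fun n => hx (n + 1)⟩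
  · rintro ⟨h0, h⟩ (_ | n)
    · exact h0
    · exact h n

/-- `C_α` is the largest forward invariant set of the expanding map in the two intervals. -/
lemma subset_middleCantor {S : Set ℝ} (hS : S ⊆ Set.Icc 0 α ∪ Set.Icc (1 - α) 1)
    (hmap : Set.MapsTo (middleCantorMap α) S S) : S ⊆ middleCantor α :=
  fun _ hx n => hS (hmap.iterate n hx)

lemma middleCantor_subset_Icc (h0 : 0 < α) (h1 : α < 1 / 2) :
    middleCantor α ⊆ Set.Icc 0 1 := by
  intro x hx
  rcases middleCantor_subset_Icc_union hx with h | h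
  · exact ⟨h.1, by linarith [h.2]⟩
  · exact ⟨by linarith [h.1], h.2⟩

lemma middleCantorMap_branch (h0 : 0 < α) (h1 : α < 1 / 2) {y : ℝ} (hy : y ∈ Set.Icc (0 : ℝ) 1)
    {e : ℤ} (he : e ∈ ({0, 1} : Finset ℤ)) :
    (1 - α) * e + α * y ∈ Set.Icc 0 α ∪ Set.Icc (1 - α) 1 ∧
      middleCantorMap α ((1 - α) * e + α * y) = y := by
  obtain ⟨hy0, hy1⟩ := hy
  have h2 : 0 ≤ α * y := by positivity
  have h3 : α * y ≤ α := mul_le_of_le_one_right h0.le hy1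
  simp only [Finset.mem_insert, Finset.mem_singleton] at he
  rcases he with rfl | rfl
  · push_cast
    rw [mul_zero, zero_add, middleCantorMap, if_pos h3]
    exact ⟨Or.inl ⟨h2, h3⟩, by field_simp⟩
  · push_cast
    rw [mul_one, middleCantorMap, if_neg (by linarith)]
    exact ⟨Or.inr ⟨by linarith, by linarith⟩, by field_simp; ring⟩

/-- `C_α` is the attractor of the two inverse branches of its expanding map. -/
lemma mem_middleCantor_iff_branch (h0 : 0 < α) (h1 : α < 1 / 2) {x : ℝ} :
    x ∈ middleCantor α ↔
      ∃ e ∈ ({0, 1} : Finset ℤ), ∃ y ∈ middleCantor α, x = (1 - α) * e + α * y := by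
  constructor
  · intro hx
    obtain ⟨-, hmap⟩ := mem_middleCantor_iff.1 hx
    rcases middleCantor_subset_Icc_union hx with h | h
    · refine ⟨0, by simp, _, hmap, ?_⟩
      rw [middleCantorMap, if_pos h.2]
      push_cast
      field_simp
      ring
    · refine ⟨1, by simp, _, hmap, ?_⟩
      rw [middleCantorMap, if_neg (by linarith [h.1])]
      push_cast
      field_simp
      ring
  · rintro ⟨e, he, y, hy, rfl⟩
    obtain ⟨h2, h3⟩ := middleCantorMap_branch h0 h1 (middleCantor_subset_Icc h0 h1 hy) he
    exact mem_middleCantor_iff.2 ⟨h2, h3.symm ▸ hy⟩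

lemma zero_mem_middleCantor (h0 : 0 < α) : (0 : ℝ) ∈ middleCantor α := by
  refine subset_middleCantor (S := {0}) ?_ ?_ rfl
  · rintro _ rfl
    exact Or.inl ⟨le_rfl, h0.le⟩
  · rintro _ rfl
    simp [middleCantorMap, h0.le]

lemma isCompact_middleCantor (h0 : 0 < α) (h1 : α < 1 / 2) : IsCompact (middleCantor α) := by
  have hsub := middleCantor_subset_Icc h0 h1
  have hcl : closure (middleCantor α) ⊆ Set.Icc 0 1 := closure_minimal hsub isClosed_Icc
  have hcomp : IsCompact (closure (middleCantor α)) :=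
    isCompact_Icc.of_isClosed_subset isClosed_closure hcl
  -- The union of the images of the closure under the two branches is closed.
  have hbranch : ∀ x ∈ closure (middleCantor α), ∃ e ∈ ({0, 1} : Finset ℤ),
      ∃ y ∈ closure (middleCantor α), x = (1 - α) * e + α * y := by
    have hclosed : IsClosed (⋃ e ∈ ({0, 1} : Finset ℤ),
        (fun y => (1 - α) * (e : ℝ) + α * y) '' closure (middleCantor α)) :=
      Set.Finite.isClosed_biUnion (Finset.finite_toSet _) fun e _ =>
        (hcomp.image (by fun_prop)).isClosed
    intro x hx
    have := closure_minimal (fun x hx => ?_) hclosed hx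
    · simp only [Set.mem_iUnion, exists_prop] at this
      obtain ⟨e, he, y, hy, rfl⟩ := this
      exact ⟨e, he, y, hy, rfl⟩
    · obtain ⟨e, he, y, hy, rfl⟩ := (mem_middleCantor_iff_branch h0 h1).1 hx
      simp only [Set.mem_iUnion, exists_prop]
      exact ⟨e, he, y, subset_closure hy, rfl⟩
  have hclosure : closure (middleCantor α) ⊆ middleCantor α := by
    refine subset_middleCantor ?_ ?_
    · intro x hx
      obtain ⟨e, he, y, hy, rfl⟩ := hbranch x hx
      exact (middleCantorMap_branch h0 h1 (hcl hy) he).1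
    · intro x hx
      obtain ⟨e, he, y, hy, rfl⟩ := hbranch x hx
      rwa [(middleCantorMap_branch h0 h1 (hcl hy) he).2]
  rwa [(subset_closure.antisymm hclosure)]

end MiddleCantor

/-! ### The difference set as a self-similar set -/

/-- The difference set `C_α - (2 / γ) C_β` with `α = γ⁻³` and `β = γ⁻²`. -/
def goldenDifference : Set ℝ :=
  cantorDifference (Real.goldenRatio⁻¹ ^ 3) (Real.goldenRatio⁻¹ ^ 2) (2 * Real.goldenRatio⁻¹)

lemma goldenRatio_inv_eq : Real.goldenRatio⁻¹ = Real.goldenRatio - 1 := by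
  rw [Real.inv_goldenRatio, goldenConj_eq]; ring

lemma goldenRatio_inv_sq : Real.goldenRatio⁻¹ ^ 2 = 1 - Real.goldenRatio⁻¹ := by
  rw [goldenRatio_inv_eq]; linear_combination Real.goldenRatio_sq

lemma goldenRatio_inv_cube : Real.goldenRatio⁻¹ ^ 3 = 2 * Real.goldenRatio⁻¹ - 1 := by
  linear_combination (Real.goldenRatio⁻¹ - 1) * goldenRatio_inv_sq

lemma goldenRatio_inv_mem_Ioo : Real.goldenRatio⁻¹ ∈ Set.Ioo 0.618 0.6181 := by
  rw [goldenRatio_inv_eq]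
  constructor <;> linarith [goldenRatio_gt, goldenRatio_lt]

lemma goldenRatio_inv_sq_lt : Real.goldenRatio⁻¹ ^ 2 < 1 / 2 := by
  rw [goldenRatio_inv_sq]; linarith [goldenRatio_inv_mem_Ioo.1]

lemma goldenRatio_inv_cube_lt : Real.goldenRatio⁻¹ ^ 3 < 1 / 2 := by
  rw [goldenRatio_inv_cube]; linarith [goldenRatio_inv_mem_Ioo.2]

lemma goldenRatio_inv_pos : 0 < Real.goldenRatio⁻¹ := inv_pos.2 Real.goldenRatio_pos

lemma isCompact_goldenDifference : IsCompact goldenDifference := by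
  have h1 := isCompact_middleCantor (pow_pos goldenRatio_inv_pos 3) goldenRatio_inv_cube_lt
  have h2 := isCompact_middleCantor (pow_pos goldenRatio_inv_pos 2) goldenRatio_inv_sq_lt
  convert (h1.prod h2).image
    (f := fun p : ℝ × ℝ => p.1 - 2 * Real.goldenRatio⁻¹ * p.2) (by fun_prop) using 1
  ext t
  constructor
  · rintro ⟨x, hx, y, hy, rfl⟩
    exact ⟨(x, y), ⟨hx, hy⟩, rfl⟩
  · rintro ⟨⟨x, y⟩, ⟨hx, hy⟩, rfl⟩
    exact ⟨x, hx, y, hy, rfl⟩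

lemma abs_le_two_of_mem_goldenDifference {t : ℝ} (ht : t ∈ goldenDifference) : |t| ≤ 2 := by
  obtain ⟨x, hx, y, hy, rfl⟩ := ht
  have hx' := middleCantor_subset_Icc (pow_pos goldenRatio_inv_pos 3) goldenRatio_inv_cube_lt hx
  have hy' := middleCantor_subset_Icc (pow_pos goldenRatio_inv_pos 2) goldenRatio_inv_sq_lt hy
  have hu := goldenRatio_inv_mem_Ioo
  rw [abs_le]
  constructor <;> nlinarith [hx'.1, hx'.2, hy'.1, hy'.2, hu.1, hu.2]

lemma zero_mem_goldenDifference : (0 : ℝ) ∈ goldenDifference :=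
  ⟨0, zero_mem_middleCantor (pow_pos goldenRatio_inv_pos 3), 0,
    zero_mem_middleCantor (pow_pos goldenRatio_inv_pos 2), by simp⟩

lemma exists_bits_of_mem_digits : ∀ d ∈ digits, ∃ e₀ ∈ ({0, 1} : Finset ℤ),
    ∃ e₁ ∈ ({0, 1} : Finset ℤ), ∃ f₀ ∈ ({0, 1} : Finset ℤ), ∃ f₁ ∈ ({0, 1} : Finset ℤ),
    ∃ f₂ ∈ ({0, 1} : Finset ℤ),
      (2 * e₀ - 2 * f₀ - f₁ - f₂, 3 * e₀ + e₁ - 3 * f₀ - f₁) = d := by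
  decide +kernel

lemma bits_mem_digits : ∀ e₀ ∈ ({0, 1} : Finset ℤ),
    ∀ e₁ ∈ ({0, 1} : Finset ℤ), ∀ f₀ ∈ ({0, 1} : Finset ℤ), ∀ f₁ ∈ ({0, 1} : Finset ℤ),
    ∀ f₂ ∈ ({0, 1} : Finset ℤ),
      (2 * e₀ - 2 * f₀ - f₁ - f₂, 3 * e₀ + e₁ - 3 * f₀ - f₁) ∈ digits := by
  decide +kernel

/-- Two steps of the coding of `C_α` and three steps of the coding of `C_β` contract by the same
factor `γ⁻⁶` and combine to one step of the coding of the difference set. -/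
lemma goldenDifference_step_eq (x y : ℝ) (e₀ e₁ f₀ f₁ f₂ : ℤ) :
    (1 - Real.goldenRatio⁻¹ ^ 3) * e₀ + Real.goldenRatio⁻¹ ^ 3 *
        ((1 - Real.goldenRatio⁻¹ ^ 3) * e₁ + Real.goldenRatio⁻¹ ^ 3 * x) -
      2 * Real.goldenRatio⁻¹ * ((1 - Real.goldenRatio⁻¹ ^ 2) * f₀ + Real.goldenRatio⁻¹ ^ 2 *
        ((1 - Real.goldenRatio⁻¹ ^ 2) * f₁ + Real.goldenRatio⁻¹ ^ 2 *
          ((1 - Real.goldenRatio⁻¹ ^ 2) * f₂ + Real.goldenRatio⁻¹ ^ 2 * y))) =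
    Real.goldenRatio⁻¹ ^ 6 * (x - 2 * Real.goldenRatio⁻¹ * y +
      2 * goldenVal (2 * e₀ - 2 * f₀ - f₁ - f₂, 3 * e₀ + e₁ - 3 * f₀ - f₁)) := by
  have hγ : Real.goldenRatio = 1 + Real.goldenRatio⁻¹ := by rw [goldenRatio_inv_eq]; ring
  have h2 := goldenRatio_inv_sq
  have h3 := goldenRatio_inv_cube
  rw [goldenVal_apply]
  push_cast
  generalize Real.goldenRatio⁻¹ = u at *
  have h5 : u ^ 5 = 5 * u - 3 := by linear_combination u ^ 3 * h2 + (1 - u) * h3 - 2 * h2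
  have h6 : u ^ 6 = 5 - 8 * u := by linear_combination (u ^ 3 + 2 * u - 1) * h3 + 4 * h2
  have h7 : u ^ 7 = 13 * u - 8 := by linear_combination u * h6 - 8 * h2
  rw [hγ]
  linear_combination (-e₀ + e₁ + 2 * f₀ - 2 * f₁) * h3 + (2 * f₁ - 2 * f₂) * h5 +
    (-3 * e₁ - 10 * (e₀ - f₀) + 4 * f₁ + 2 * f₂) * h6 +
    (2 * f₂ - 6 * (e₀ - f₀) - 2 * e₁ + 2 * f₁) * h7

/-- The difference set is the attractor of the contractions `s ↦ γ⁻⁶ (s + 2 d)`, `d` a digit. -/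
lemma mem_goldenDifference_iff {t : ℝ} : t ∈ goldenDifference ↔
    ∃ d ∈ digits, ∃ s ∈ goldenDifference,
      t = Real.goldenRatio⁻¹ ^ 6 * (s + 2 * goldenVal d) := by
  have hα (x : ℝ) := mem_middleCantor_iff_branch (pow_pos goldenRatio_inv_pos 3)
    goldenRatio_inv_cube_lt (x := x)
  have hβ (x : ℝ) := mem_middleCantor_iff_branch (pow_pos goldenRatio_inv_pos 2)
    goldenRatio_inv_sq_lt (x := x)
  constructor
  · rintro ⟨x, hx, y, hy, rfl⟩
    obtain ⟨e₀, he₀, x₁, hx₁, rfl⟩ := (hα _).1 hx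
    obtain ⟨e₁, he₁, x₂, hx₂, rfl⟩ := (hα _).1 hx₁
    obtain ⟨f₀, hf₀, y₁, hy₁, rfl⟩ := (hβ _).1 hy
    obtain ⟨f₁, hf₁, y₂, hy₂, rfl⟩ := (hβ _).1 hy₁
    obtain ⟨f₂, hf₂, y₃, hy₃, rfl⟩ := (hβ _).1 hy₂
    exact ⟨_, bits_mem_digits e₀ he₀ e₁ he₁ f₀ hf₀ f₁ hf₁ f₂ hf₂, _, ⟨x₂, hx₂, y₃, hy₃, rfl⟩,
      goldenDifference_step_eq ..⟩
  · rintro ⟨d, hd, _, ⟨x, hx, y, hy, rfl⟩, rfl⟩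
    obtain ⟨e₀, he₀, e₁, he₁, f₀, hf₀, f₁, hf₁, f₂, hf₂, rfl⟩ := exists_bits_of_mem_digits d hd
    exact ⟨_, (hα _).2 ⟨e₀, he₀, _, (hα _).2 ⟨e₁, he₁, x, hx, rfl⟩, rfl⟩, _,
      (hβ _).2 ⟨f₀, hf₀, _, (hβ _).2 ⟨f₁, hf₁, _, (hβ _).2 ⟨f₂, hf₂, y, hy, rfl⟩, rfl⟩, rfl⟩,
      (goldenDifference_step_eq ..).symm⟩

lemma goldenRatio_inv_pow_six_mul : Real.goldenRatio⁻¹ ^ 6 * Real.goldenRatio ^ 6 = 1 := by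
  rw [← mul_pow, inv_mul_cancel₀ Real.goldenRatio_ne_zero, one_pow]

lemma mem_goldenDifference_iff_digitSums (n : ℕ) {t : ℝ} : t ∈ goldenDifference ↔
    ∃ x ∈ digitSums n, ∃ s ∈ goldenDifference,
      t = (Real.goldenRatio⁻¹ ^ 6) ^ n * (s + 2 * goldenVal x) := by
  induction n with
  | zero => simp [digitSums]
  | succ n ih =>
    have key (s : ℝ) (y d : ℤ × ℤ) : (Real.goldenRatio⁻¹ ^ 6) ^ (n + 1) *
          (s + 2 * goldenVal (mulUnit y + d)) =
        (Real.goldenRatio⁻¹ ^ 6) ^ n *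
          (Real.goldenRatio⁻¹ ^ 6 * (s + 2 * goldenVal d) + 2 * goldenVal y) := by
      rw [map_add, goldenVal_mulUnit, pow_succ]
      linear_combination (2 * (Real.goldenRatio⁻¹ ^ 6) ^ n * goldenVal y) *
        goldenRatio_inv_pow_six_mul
    rw [ih]
    constructor
    · rintro ⟨y, hy, s', hs', rfl⟩
      obtain ⟨d, hd, s, hs, rfl⟩ := mem_goldenDifference_iff.1 hs'
      exact ⟨_, mem_digitSums_succ.2 ⟨y, hy, d, hd, rfl⟩, s, hs, (key s y d).symm⟩
    · rintro ⟨x, hx, s, hs, rfl⟩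
      obtain ⟨y, hy, d, hd, rfl⟩ := mem_digitSums_succ.1 hx
      exact ⟨y, hy, _, mem_goldenDifference_iff.2 ⟨d, hd, s, hs, rfl⟩, key s y d⟩

/-! ### The nets of the difference set -/

lemma exists_of_mem_digitSums_add {k : ℕ} (m : ℕ) : ∀ x ∈ digitSums (k + m),
    ∃ u ∈ digitSums k, ∃ w ∈ digitSums m, mulUnit^[m] u + w = x := by
  induction m with
  | zero => exact fun x hx => ⟨x, hx, 0, by simp [digitSums], by simp⟩
  | succ m ih =>
    intro x hx
    obtain ⟨y, hy, d, hd, rfl⟩ := mem_digitSums_succ.1 hx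
    obtain ⟨u, hu, w, hw, rfl⟩ := ih y hy
    refine ⟨u, hu, _, mem_digitSums_succ.2 ⟨w, hw, d, hd, rfl⟩, ?_⟩
    rw [Function.iterate_succ_apply', map_add, add_assoc]

lemma goldenVal_iterate_mulUnit (m : ℕ) (x : ℤ × ℤ) :
    goldenVal (mulUnit^[m] x) = (Real.goldenRatio ^ 6) ^ m * goldenVal x := by
  induction m with
  | zero => simp
  | succ m ih => rw [Function.iterate_succ_apply', goldenVal_mulUnit, ih]; ring

/-- At most nine digit sums lie in an interval of length `4`, as they are `1 / 2`-separated. -/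
lemma card_filter_digitSums_le (n : ℕ) (a : ℝ) :
    ((digitSums n).filter fun x => |goldenVal x - a| ≤ 2).card ≤ 9 := by
  have h := Finset.card_le_card_of_injOn (s := (digitSums n).filter fun x => |goldenVal x - a| ≤ 2)
    (t := Finset.Icc (-4 : ℤ) 4) (fun x => ⌊2 * (goldenVal x - a)⌋) ?_ ?_
  · simpa using h
  · intro x hx
    have h2 := abs_le.1 (Finset.mem_filter.1 hx).2
    simp only [Finset.coe_Icc, Set.mem_Icc]
    refine ⟨Int.le_floor.2 (by push_cast; linarith), ?_⟩
    have : (⌊2 * (goldenVal x - a)⌋ : ℝ) ≤ (4 : ℤ) :=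
      (Int.floor_le _).trans (by push_cast; linarith)
    exact_mod_cast this
  · intro x hx y hy hxy
    by_contra hne
    have h1 := Int.abs_sub_lt_one_of_floor_eq_floor hxy
    have h2 := half_le_abs_sub (Finset.mem_filter.1 hx).1 (Finset.mem_filter.1 hy).1 hne
    have h3 : 2 * (goldenVal x - a) - 2 * (goldenVal y - a) =
        2 * (goldenVal x - goldenVal y) := by ring
    rw [h3, abs_mul, abs_two] at h1
    linarith

/-- The points of the difference set coded by `n` digits followed by zeros. -/
noncomputable def goldenNet (n : ℕ) : Finset ℝ :=
  (digitSums n).image fun x => (Real.goldenRatio⁻¹ ^ 6) ^ n * (2 * goldenVal x)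

lemma goldenVal_mem_goldenDifference {n : ℕ} {x : ℤ × ℤ} (hx : x ∈ digitSums n) :
    (Real.goldenRatio⁻¹ ^ 6) ^ n * (2 * goldenVal x) ∈ goldenDifference :=
  (mem_goldenDifference_iff_digitSums n).2 ⟨x, hx, 0, zero_mem_goldenDifference, by rw [zero_add]⟩

lemma card_goldenNet (n : ℕ) : (goldenNet n).card = (digitSums n).card := by
  refine Finset.card_image_of_injOn fun x hx y hy hxy => ?_
  by_contra hne
  have h := half_le_abs_sub hx hy hne
  have hpos : (Real.goldenRatio⁻¹ ^ 6) ^ n ≠ 0 := by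
    have := goldenRatio_inv_pos; positivity
  have h' : goldenVal x = goldenVal y := by
    have := mul_left_cancel₀ hpos hxy
    linarith
  rw [h', sub_self, abs_zero] at h
  linarith

/-- A digit sum of length `k + m` is `γ ^ (6 m) u + w` with `u` of length `k` and `w` of length `m`.
Near `t` there are at most nine choices of `u`, and at most `3 L ^ m` of `w`. -/
lemma card_filter_goldenNet_le {L : ℝ} (hL : L ^ 3 - 19 * L ^ 2 + 31 * L + 3 = 0) (hL' : 17 < L)
    (k m : ℕ) (t : ℝ) :
    (((goldenNet (k + m)).filter
      fun x => |x - t| ≤ 2 * (Real.goldenRatio⁻¹ ^ 6) ^ k).card : ℝ) ≤ 27 * L ^ m := by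
  have hr : 0 < Real.goldenRatio⁻¹ ^ 6 := pow_pos goldenRatio_inv_pos 6
  set r := Real.goldenRatio⁻¹ ^ 6 with hr_def
  set U := (digitSums k).filter fun x => |goldenVal x - t / (2 * r ^ k)| ≤ 2 with hU
  have hsub : ((goldenNet (k + m)).filter fun x => |x - t| ≤ 2 * r ^ k) ⊆
      (U ×ˢ digitSums m).image
        fun p => r ^ (k + m) * (2 * goldenVal (mulUnit^[m] p.1 + p.2)) := by
    intro y hy
    obtain ⟨hy, hyt⟩ := Finset.mem_filter.1 hy
    obtain ⟨x, hx, rfl⟩ := Finset.mem_image.1 hy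
    obtain ⟨u, hu, w, hw, rfl⟩ := exists_of_mem_digitSums_add m x hx
    refine Finset.mem_image.2 ⟨(u, w), Finset.mem_product.2 ⟨?_, hw⟩, rfl⟩
    refine Finset.mem_filter.2 ⟨hu, ?_⟩
    have hw2 := abs_le_two_of_mem_goldenDifference (goldenVal_mem_goldenDifference hw)
    rw [← hr_def] at hw2 hyt
    have hrm : r ^ m * (Real.goldenRatio ^ 6) ^ m = 1 := by
      rw [← mul_pow, goldenRatio_inv_pow_six_mul, one_pow]
    have h1 : r ^ (k + m) * (2 * goldenVal (mulUnit^[m] u + w)) - t =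
        2 * r ^ k * (goldenVal u - t / (2 * r ^ k)) + r ^ k * (r ^ m * (2 * goldenVal w)) := by
      have : 2 * r ^ k * (t / (2 * r ^ k)) = t := by field_simp
      rw [map_add, goldenVal_iterate_mulUnit, pow_add, mul_sub, this]
      linear_combination (2 * r ^ k * goldenVal u) * hrm
    rw [h1] at hyt
    have h2 : |r ^ k * (r ^ m * (2 * goldenVal w))| ≤ r ^ k * 2 := by
      rw [abs_mul, abs_of_pos (by positivity : 0 < r ^ k)]
      gcongr
    have h3 := abs_sub_abs_le_abs_add (2 * r ^ k * (goldenVal u - t / (2 * r ^ k)))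
      (r ^ k * (r ^ m * (2 * goldenVal w)))
    rw [abs_mul, abs_of_pos (by positivity : 0 < 2 * r ^ k)] at h3
    have h4 : 2 * r ^ k * |goldenVal u - t / (2 * r ^ k)| ≤ 2 * r ^ k * 2 := by linarith
    exact le_of_mul_le_mul_left h4 (by positivity)
  have h1 := (Finset.card_le_card hsub).trans Finset.card_image_le
  rw [Finset.card_product] at h1
  have h2 : (U.card : ℝ) ≤ 9 := by exact_mod_cast card_filter_digitSums_le k _
  calc (((goldenNet (k + m)).filter fun x => |x - t| ≤ 2 * r ^ k).card : ℝ)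
      ≤ U.card * (digitSums m).card := by exact_mod_cast h1
    _ ≤ 9 * (3 * L ^ m) :=
        mul_le_mul h2 (card_digitSums_le hL hL' m) (by positivity) (by norm_num)
    _ = 27 * L ^ m := by ring

theorem isRegularNet_goldenNet {L : ℝ} (hL : L ^ 3 - 19 * L ^ 2 + 31 * L + 3 = 0) (hL' : 17 < L) :
    IsRegularNet goldenDifference (Real.goldenRatio⁻¹ ^ 6) L 2 1 27 goldenNet where
  r_pos := pow_pos goldenRatio_inv_pos 6
  r_lt_one := pow_lt_one₀ goldenRatio_inv_pos.le (by linarith [goldenRatio_inv_mem_Ioo.2])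
    (by norm_num)
  one_lt_L := by linarith
  R_pos := by norm_num
  c_pos := by norm_num
  K_pos := by norm_num
  abs_le _ := abs_le_two_of_mem_goldenDifference
  subset n x hx := by
    obtain ⟨y, hy, rfl⟩ := Finset.mem_image.1 hx
    exact goldenVal_mem_goldenDifference hy
  cover n t ht := by
    obtain ⟨x, hx, s, hs, rfl⟩ := (mem_goldenDifference_iff_digitSums n).1 ht
    refine ⟨_, Finset.mem_image_of_mem _ hx, ?_⟩
    have hr : 0 < (Real.goldenRatio⁻¹ ^ 6) ^ n := pow_pos (pow_pos goldenRatio_inv_pos 6) n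
    rw [← mul_sub, add_sub_cancel_right, abs_mul, abs_of_pos hr, mul_comm]
    gcongr
    exact abs_le_two_of_mem_goldenDifference hs
  sep n x hx y hy hxy := by
    obtain ⟨x, hx', rfl⟩ := Finset.mem_image.1 hx
    obtain ⟨y, hy', rfl⟩ := Finset.mem_image.1 hy
    have hr : 0 < (Real.goldenRatio⁻¹ ^ 6) ^ n := pow_pos (pow_pos goldenRatio_inv_pos 6) n
    have hne : x ≠ y := fun h => hxy (by rw [h])
    have h := half_le_abs_sub hx' hy' hne
    rw [← mul_sub, ← mul_sub, abs_mul, abs_of_pos hr, abs_mul, abs_two]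
    nlinarith
  le_card n := by
    rw [card_goldenNet]
    exact pow_le_card_digitSums hL (by linarith) n
  local_card := card_filter_goldenNet_le hL hL'

/-! ### The eigenvalue -/

/-- The characteristic polynomial of the matrix is `x (x - 1) (x³ - 19 x² + 31 x + 3)`. -/
lemma hasEigenvalue_matrixA_iff {μ : ℝ} :
    Module.End.HasEigenvalue (Matrix.toLin' matrixA) μ ↔
      μ * (μ - 1) * (μ ^ 3 - 19 * μ ^ 2 + 31 * μ + 3) = 0 := by
  rw [Module.End.hasEigenvalue_iff_isRoot_charpoly, Matrix.charpoly_toLin', Polynomial.IsRoot.def,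
    Matrix.eval_charpoly]
  have : (Matrix.scalar (Fin 5) μ - matrixA).det =
      μ * (μ - 1) * (μ ^ 3 - 19 * μ ^ 2 + 31 * μ + 3) := by
    rw [matrixA, Matrix.det_succ_row_zero]
    simp [Matrix.det_succ_row_zero, Fin.sum_univ_succ, Fin.succAbove, Matrix.submatrix]
    ring
  rw [this]

lemma exists_root_cubic : ∃ L : ℝ, 17.186 < L ∧ L < 17.187 ∧
    L ^ 3 - 19 * L ^ 2 + 31 * L + 3 = 0 := by
  have h := intermediate_value_Ioo (f := fun x : ℝ => x ^ 3 - 19 * x ^ 2 + 31 * x + 3)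
    (by norm_num : (17.186 : ℝ) ≤ 17.187) (by fun_prop)
  obtain ⟨L, hL, h0⟩ := h (show (0 : ℝ) ∈ _ by constructor <;> norm_num)
  exact ⟨L, hL.1, hL.2, h0⟩

lemma isGreatest_hasEigenvalue_matrixA {L : ℝ} (hL : L ^ 3 - 19 * L ^ 2 + 31 * L + 3 = 0)
    (hL' : 17 < L) :
    IsGreatest {μ : ℝ | Module.End.HasEigenvalue (Matrix.toLin' matrixA) μ} L := by
  refine ⟨hasEigenvalue_matrixA_iff.2 (by rw [hL, mul_zero]), fun μ hμ => ?_⟩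
  by_contra! hlt
  have h := hasEigenvalue_matrixA_iff.1 hμ
  -- The cubic is increasing beyond its root `L`.
  have h1 : 0 < (μ - L) * (μ ^ 2 + μ * L + L ^ 2 - 19 * (μ + L) + 31) :=
    mul_pos (by linarith) (by nlinarith)
  have h2 : μ ^ 3 - 19 * μ ^ 2 + 31 * μ + 3 =
      (μ - L) * (μ ^ 2 + μ * L + L ^ 2 - 19 * (μ + L) + 31) := by linear_combination hL
  rw [h2] at h
  have h3 : 0 < μ * (μ - 1) := mul_pos (by linarith) (by linarith)
  exact absurd h (mul_pos h3 h1).ne'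

lemma logb_bounds {L : ℝ} (h1 : 17.186 < L) (h2 : L < 17.187) :
    0.9850 < Real.logb (Real.goldenRatio ^ 6) L ∧
      Real.logb (Real.goldenRatio ^ 6) L < 0.9851 := by
  have hL : 0 < L := by linarith
  obtain ⟨hb1, hb2⟩ : 17.9442 < Real.goldenRatio ^ 6 ∧ Real.goldenRatio ^ 6 < 17.9443 := by
    rw [goldenRatio_pow_six, Real.goldenRatio]
    have h3 : (2.23605 : ℝ) < √5 := Real.lt_sqrt_of_sq_lt (by norm_num)
    have h4 : √5 < (2.23607 : ℝ) := (Real.sqrt_lt' (by norm_num)).2 (by norm_num)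
    constructor <;> linarith
  generalize Real.goldenRatio ^ 6 = b at *
  have hb : 1 < b := by linarith
  constructor
  · -- `0.985 = 197 / 200`
    have h : b ^ 197 < L ^ 200 :=
      calc b ^ 197 < 17.9443 ^ 197 := pow_lt_pow_left₀ hb2 (by linarith) (by norm_num)
        _ < (17.186 : ℝ) ^ 200 := by norm_num
        _ < L ^ 200 := pow_lt_pow_left₀ h1 (by norm_num) (by norm_num)
    have := Real.logb_lt_logb hb (by positivity) h
    rw [Real.logb_pow, Real.logb_pow, Real.logb_self_eq_one hb] at this
    norm_num at this ⊢
    linarith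
  · -- `66 / 67 < 0.9851`
    have h : L ^ 67 < b ^ 66 :=
      calc L ^ 67 < 17.187 ^ 67 := pow_lt_pow_left₀ h2 hL.le (by norm_num)
        _ < (17.9442 : ℝ) ^ 66 := by norm_num
        _ < b ^ 66 := pow_lt_pow_left₀ hb1 (by norm_num) (by norm_num)
    have := Real.logb_lt_logb hb (by positivity) h
    rw [Real.logb_pow, Real.logb_pow, Real.logb_self_eq_one hb] at this
    norm_num at this ⊢
    linarith

theorem mainTheorem4 (γ p q α β : ℝ)
    (hγ : γ = Real.goldenRatio) (hp : p = γ ^ 3) (hq : q = γ ^ 2)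
    (hα : α = 1 / p) (hβ : β = 1 / q) :
    ∃ L : ℝ,
      IsGreatest {μ : ℝ | Module.End.HasEigenvalue (Matrix.toLin' matrixA) μ} L ∧
      dimH (cantorDifference α β (2 / γ)) = ENNReal.ofReal (Real.logb (p ^ 2) L) ∧
      HasBoxDimension (cantorDifference α β (2 / γ)) (Real.logb (p ^ 2) L) ∧
      17.186 < L ∧ L < 17.187 ∧
      0.9850 < Real.logb (p ^ 2) L ∧ Real.logb (p ^ 2) L < 0.9851 := by
  obtain ⟨L, h1, h2, hL⟩ := exists_root_cubic
  have hL' : 17 < L := by linarith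
  have hT : cantorDifference α β (2 / γ) = goldenDifference := by
    rw [hα, hβ, hp, hq, hγ, goldenDifference, one_div, one_div, inv_pow, inv_pow, div_eq_mul_inv]
  have hr : p ^ 2 = (Real.goldenRatio⁻¹ ^ 6)⁻¹ := by
    rw [hp, hγ, inv_pow, inv_inv, ← pow_mul]
  have hnet := isRegularNet_goldenNet hL hL'
  have hlog := logb_bounds h1 h2
  rw [hT, hr]
  rw [← inv_inv (Real.goldenRatio ^ 6), ← inv_pow] at hlog
  exact ⟨L, isGreatest_hasEigenvalue_matrixA hL hL',
    hnet.dimH_eq isCompact_goldenDifference.isClosed, hnet.hasBoxDimension, h1, h2, hlog⟩
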